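/- Let $R$ be a commutative ring with $1$, $I$ an ideal of $R$, and $n\ge 3$. Let $\mathrm{Um}_n(R)$ be the set of unimodular rows of length $n$ (rows $v$ with $v\cdot w^t=1$ for some $w\in R^n$), and $\mathrm{Um}_n(R,I)\subseteq \mathrm{Um}_n(R)$ the set of those congruent to $e_1=(1,0,\dots,0)$ modulo $I$. Let $\mathrm{E}_n(R)\subseteq\mathrm{GL}_n(R)$ be the subgroup generated by the elementary matrices $E_{ij}(c)=I_n+c\,e_{ij}$ ($i\ne j$, $c\in R$), $\mathrm{E}_n(R,I)$ the smallest normal subgroup of $\mathrm{E}_n(R)$ containing all $E_{21}(x)$, $x\in I$, and $\mathrm{MSE}_n(R)=\mathrm{Um}_n(R)/\mathrm{E}_n(R)$, $\mathrm{MSE}_n(R,I)=\mathrm{Um}_n(R,I)/\mathrm{E}_n(R,I)$ the sets of orbits. For $S=R$ or $S=\mathbb Z$ let $S\oplus I$ be the excision ring, with coordinatewise addition and $(s,i)(t,j)=(st,\,sj+ti+ij)$. A group operation $*$ on $\mathrm{MSE}_n(R)$ is given by the Vaserstein--van der Kallen rule if for all $v=(a,a_2,\dots,a_n)$ and $w=(b,a_2,\dots,a_n)$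 in $\mathrm{Um}_n(R)$ and all $p\in R$ with $ap\equiv 1 \pmod{(a_2,\dots,a_n)}$, $$[w]*[v]=[(a(b+p)-1,\ a_2(b+p),\ a_3,\dots,a_n)];$$ it is then nice if for all such $v,w$ $$[(b,a_2,\dots,a_n)]*[(a,a_2,\dots,a_n)]=[(ab,a_2,\dots,a_n)].$$ A group operation on $\mathrm{MSE}_n(R,I)$ is given by the Vaserstein--van der Kallen rule if the operation it induces on $\mathrm{MSE}_n(\mathbb Z\oplus I)$, through the natural bijections $F:\mathrm{MSE}_n(\mathbb Z\oplus I,0\oplus I)\to\mathrm{MSE}_n(R,I)$, induced by $(m,i)\mapsto m+i$, and $G:\mathrm{MSE}_n(\mathbb Z\oplus I,0\oplus I)\to\mathrm{MSE}_n(\mathbb Z\oplus I)$, $[v]\mapsto[v]$, is given by that rule. It is then nice if for every $i\in\{1,\dots,n\}$ and all rows in $\mathrm{Um}_n(R,I)$ that agree outside the $i$-th coordinate, $$[(a_1,\dots,a_{i-1},b,a_{i+1},\dots,a_n)]*[(a_1,\dots,a_{i-1},a,a_{i+1},\dots,a_n)]=[(a_1,\dots,a_{i-1},ab,a_{i+1},\dots,a_n)].$$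 Suppose that $\mathrm{MSE}_n(R,I)$ and $\mathrm{MSE}_n(R\oplus I)$ both carry group structures given by the Vaserstein--van der Kallen rule. If the group structure on $\mathrm{MSE}_n(R\oplus I)$ is nice, then the group structure on $\mathrm{MSE}_n(R,I)$ is nice. -/

import Mathlib

open Matrix

/-- A row is unimodular if some row pairs with it to `1`. -/
def IsUnimodular {n : ℕ} {R : Type*} [CommRing R] (v : Fin n → R) : Prop :=
  ∃ w : Fin n → R, v ⬝ᵥ w = 1

/-- `Um_n(R)`, the unimodular rows of length `n`. -/
abbrev Um (n : ℕ) (R : Type*) [CommRing R] : Type _ :=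
  {v : Fin n → R // IsUnimodular v}

/-- `Um_n(R, I)`, the unimodular rows congruent to `e₁ = (1, 0, …, 0)` modulo `I`. -/
abbrev UmRel (n : ℕ) [NeZero n] (R : Type*) [CommRing R] (I : Ideal R) : Type _ :=
  {v : Fin n → R // IsUnimodular v ∧ v 0 - 1 ∈ I ∧ ∀ j, j ≠ 0 → v j ∈ I}

/-- `E_n(R)`: the subgroup of `GL_n(R)` generated by the elementary matrices `1 + c e_{ij}`. -/
def elemGroup (n : ℕ) (R : Type*) [CommRing R] : Subgroup (GL (Fin n) R) :=
  Subgroup.closure {g | ∃ i j : Fin n, i ≠ j ∧ ∃ c : R,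
    (g : Matrix (Fin n) (Fin n) R) = Matrix.transvection i j c}

/-- `E_n(R, I)`: the smallest normal subgroup of `E_n(R)` containing the matrices `E_{21}(x)`,
`x ∈ I`, viewed as a subgroup of `GL_n(R)`. Indices start at `0`. -/
def elemGroupRel (n : ℕ) [NeZero n] (R : Type*) [CommRing R] (I : Ideal R) :
    Subgroup (GL (Fin n) R) :=
  (Subgroup.normalClosure {g : elemGroup n R | ∃ x ∈ I,
    ((g : GL (Fin n) R) : Matrix (Fin n) (Fin n) R) = Matrix.transvection 1 0 x}).map
      (elemGroup n R).subtype

/-- The orbit relation of a subgroup `H` of `GL_n(R)`, acting on row vectors from the right,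
restricted to a set of rows. -/
def rowSetoid {n : ℕ} {R : Type*} [CommRing R] (H : Subgroup (GL (Fin n) R))
    (P : (Fin n → R) → Prop) : Setoid {v : Fin n → R // P v} where
  r v w := ∃ g ∈ H, (v : Fin n → R) ᵥ* (g : Matrix (Fin n) (Fin n) R) = w
  iseqv :=
    { refl := fun v => ⟨1, H.one_mem, by simp⟩
      symm := by
        rintro v w ⟨g, hg, h⟩
        refine ⟨g⁻¹, H.inv_mem hg, ?_⟩
        rw [← h, Matrix.vecMul_vecMul, ← Units.val_mul, mul_inv_cancel]
        simp
      trans := by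
        rintro u v w ⟨g, hg, h⟩ ⟨k, hk, h'⟩
        refine ⟨g * k, H.mul_mem hg hk, ?_⟩
        rw [Units.val_mul, ← Matrix.vecMul_vecMul, h, h'] }

/-- `MSE_n(R) = Um_n(R) / E_n(R)`. -/
def MSE (n : ℕ) (R : Type*) [CommRing R] : Type _ :=
  Quotient (rowSetoid (elemGroup n R) (fun v => IsUnimodular v))

/-- The class of a unimodular row in `MSE_n(R)`. -/
def MSE.mk {n : ℕ} {R : Type*} [CommRing R] (v : Um n R) : MSE n R :=
  Quotient.mk _ v

/-- `MSE_n(R, I) = Um_n(R, I) / E_n(R, I)`. -/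
def MSERel (n : ℕ) [NeZero n] (R : Type*) [CommRing R] (I : Ideal R) : Type _ :=
  Quotient (rowSetoid (elemGroupRel n R I)
    (fun v => IsUnimodular v ∧ v 0 - 1 ∈ I ∧ ∀ j, j ≠ 0 → v j ∈ I))

/-- The class of a relative unimodular row in `MSE_n(R, I)`. -/
def MSERel.mk {n : ℕ} [NeZero n] {R : Type*} [CommRing R] {I : Ideal R} (v : UmRel n R I) :
    MSERel n R I :=
  Quotient.mk _ v

section functoriality

variable {n : ℕ} {A B : Type*} [CommRing A] [CommRing B]

theorem IsUnimodular.map (f : A →+* B) {v : Fin n → A} (hv : IsUnimodular v) :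
    IsUnimodular (fun j => f (v j)) := by
  obtain ⟨w, hw⟩ := hv
  exact ⟨fun j => f (w j), by simpa [dotProduct] using congrArg f hw⟩

theorem map_transvection_val (f : A →+* B) (i j : Fin n) (c : A) :
    (Matrix.transvection i j c).map f = Matrix.transvection i j (f c) := by
  ext k l
  simp only [Matrix.transvection, Matrix.map_apply, Matrix.add_apply, Matrix.single_apply,
    Matrix.one_apply, map_add]
  split_ifs <;> simp

theorem elemGroup_map (f : A →+* B) {g : GL (Fin n) A} (hg : g ∈ elemGroup n A) :
    Matrix.GeneralLinearGroup.map f g ∈ elemGroup n B := by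
  have h : elemGroup n A ≤ (elemGroup n B).comap (Matrix.GeneralLinearGroup.map f) := by
    refine (Subgroup.closure_le _).2 ?_
    rintro g ⟨i, j, hij, c, hc⟩
    refine Subgroup.subset_closure ⟨i, j, hij, f c, ?_⟩
    rw [← map_transvection_val, ← hc]
    rfl
  exact h hg

theorem elemGroupRel_map [NeZero n] (f : A →+* B) {I : Ideal A} {J : Ideal B}
    (hf : ∀ x ∈ I, f x ∈ J) {g : GL (Fin n) A} (hg : g ∈ elemGroupRel n A I) :
    Matrix.GeneralLinearGroup.map f g ∈ elemGroupRel n B J := by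
  let φ : elemGroup n A →* elemGroup n B :=
    ((Matrix.GeneralLinearGroup.map f).comp (elemGroup n A).subtype).codRestrict (elemGroup n B)
      (fun g => elemGroup_map f g.2)
  obtain ⟨g, hg, rfl⟩ := hg
  refine ⟨φ g, ?_, rfl⟩
  have h : Subgroup.normalClosure {g : elemGroup n A | ∃ x ∈ I,
      ((g : GL (Fin n) A) : Matrix (Fin n) (Fin n) A) = Matrix.transvection 1 0 x} ≤
      (Subgroup.normalClosure {g : elemGroup n B | ∃ x ∈ J,
      ((g : GL (Fin n) B) : Matrix (Fin n) (Fin n) B) = Matrix.transvection 1 0 x}).comap φ := by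
    refine Subgroup.normalClosure_le_normal ?_
    rintro g ⟨x, hx, h⟩
    refine Subgroup.subset_normalClosure ⟨f x, hf x hx, ?_⟩
    rw [← map_transvection_val, ← h]
    rfl
  exact h hg

/-- The map `MSE_n(A, I) → MSE_n(B, J)` induced by a ring homomorphism `f` with `f(I) ⊆ J`:
`[(a_i)] ↦ [(f(a_i))]`. -/
def MSERel.map [NeZero n] (f : A →+* B) {I : Ideal A} {J : Ideal B} (hf : ∀ x ∈ I, f x ∈ J) :
    MSERel n A I → MSERel n B J :=
  Quotient.map
    (fun v => ⟨fun j => f (v.1 j), v.2.1.map f, by simpa using hf _ v.2.2.1,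
      fun j hj => hf _ (v.2.2.2 j hj)⟩)
    (by
      rintro v w ⟨g, hg, h⟩
      refine ⟨Matrix.GeneralLinearGroup.map f g, elemGroupRel_map f hf hg, ?_⟩
      funext j
      have hj : f (((v : Fin n → A) ᵥ* (g : Matrix (Fin n) (Fin n) A)) j) = f (w.1 j) := by
        rw [h]
      simpa [Matrix.vecMul, dotProduct] using hj)

/-- The map `MSE_n(A, I) → MSE_n(A)`, `[v] ↦ [v]`. -/
def MSERel.toMSE [NeZero n] {I : Ideal A} : MSERel n A I → MSE n A :=
  Quotient.map (fun v => ⟨v.1, v.2.1⟩)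
    (by
      rintro v w ⟨g, ⟨k, -, rfl⟩, h⟩
      exact ⟨k, k.2, h⟩)

end functoriality

section excision

variable {R : Type*} [CommRing R]

/-- The excision ring `R ⊕ I`. Mathlib's unitization carries coordinatewise addition, the product
`(r, i) (s, j) = (r s, r j + s i + i j)` and the unit `(1, 0)`. -/
abbrev ExcisionRing (I : Ideal R) : Type _ := Unitization R I

/-- The excision ring `ℤ ⊕ I`, with the product `(m, i) (n, j) = (m n, m j + n i + i j)`. -/
abbrev IntExcisionRing (I : Ideal R) : Type _ := Unitization ℤ I

/-- The ideal `0 ⊕ I` of `ℤ ⊕ I`. -/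
def IntExcisionRing.ideal (I : Ideal R) : Ideal (IntExcisionRing I) :=
  RingHom.ker (Unitization.fstHom ℤ I)

/-- The ring homomorphism `f : ℤ ⊕ I → R`, `f (m, i) = m + i`. -/
def IntExcisionRing.toRing (I : Ideal R) : IntExcisionRing I →+* R where
  toFun x := (x.fst : R) + (x.snd : R)
  map_one' := by simp
  map_zero' := by simp
  map_add' x y := by
    simp only [Unitization.fst_add, Unitization.snd_add, Submodule.coe_add]
    push_cast
    ring
  map_mul' x y := by
    simp
    ring

theorem IntExcisionRing.toRing_mem (I : Ideal R) :
    ∀ x ∈ IntExcisionRing.ideal I, IntExcisionRing.toRing I x ∈ I := by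
  intro x hx
  have h : x.fst = 0 := hx
  simp [IntExcisionRing.toRing, h]

/-- `F : MSE_n(ℤ ⊕ I, 0 ⊕ I) → MSE_n(R, I)`, `[(a_i)] ↦ [(f(a_i))]`. -/
def excisionF (n : ℕ) [NeZero n] (I : Ideal R) :
    MSERel n (IntExcisionRing I) (IntExcisionRing.ideal I) → MSERel n R I :=
  MSERel.map (IntExcisionRing.toRing I) (IntExcisionRing.toRing_mem I)

/-- `G : MSE_n(ℤ ⊕ I, 0 ⊕ I) → MSE_n(ℤ ⊕ I)`, `[(a_i)] ↦ [(a_i)]`. -/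
def excisionG (n : ℕ) [NeZero n] (I : Ideal R) :
    MSERel n (IntExcisionRing I) (IntExcisionRing.ideal I) → MSE n (IntExcisionRing I) :=
  MSERel.toMSE

end excision

section rules

variable {n : ℕ} [NeZero n] {R : Type*} [CommRing R]

/-- The row `(a (b + p) - 1, a₂ (b + p), a₃, …, a_n)` for `v = (a, a₂, …, a_n)`. -/
def vvRow (v : Fin n → R) (b p : R) : Fin n → R := fun j =>
  if j = 0 then v 0 * (b + p) - 1 else if j = 1 then v 1 * (b + p) else v j

/-- An operation on `MSE_n(R)` is given by the Vaserstein–van der Kallen rule: if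
`v = (a, a₂, …, a_n)` and `w = (b, a₂, …, a_n)` are unimodular and
`a p ≡ 1` modulo `(a₂, …, a_n)`, then `[w] * [v] = [(a (b + p) - 1, a₂ (b + p), a₃, …, a_n)]`.
(The row on the right is always unimodular.) -/
def IsVvRule (op : MSE n R → MSE n R → MSE n R) : Prop :=
  ∀ v w : Um n R, (∀ j, j ≠ 0 → w.1 j = v.1 j) →
    ∀ p : R, v.1 0 * p - 1 ∈ Ideal.span {x | ∃ j, j ≠ 0 ∧ x = v.1 j} →
      ∃ h : IsUnimodular (vvRow v.1 (w.1 0) p),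
        op (MSE.mk w) (MSE.mk v) = MSE.mk ⟨vvRow v.1 (w.1 0) p, h⟩

/-- `op'` is the operation on `MSE_n(ℤ ⊕ I)` induced by the operation `op` on `MSE_n(R, I)` through
`F` and `G`. -/
def IsInducedOp {I : Ideal R} (op : MSERel n R I → MSERel n R I → MSERel n R I)
    (op' : MSE n (IntExcisionRing I) → MSE n (IntExcisionRing I) → MSE n (IntExcisionRing I)) :
    Prop :=
  ∀ x y z : MSERel n (IntExcisionRing I) (IntExcisionRing.ideal I),
    excisionF n I z = op (excisionF n I x) (excisionF n I y) →
      op' (excisionG n I x) (excisionG n I y) = excisionG n I z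

/-- An operation on `MSE_n(R, I)` is given by the Vaserstein–van der Kallen rule if the operation
it induces on `MSE_n(ℤ ⊕ I)` is. -/
def IsVvRuleRel {I : Ideal R} (op : MSERel n R I → MSERel n R I → MSERel n R I) : Prop :=
  ∃ op' : MSE n (IntExcisionRing I) → MSE n (IntExcisionRing I) → MSE n (IntExcisionRing I),
    IsInducedOp op op' ∧ IsVvRule op'

/-- Niceness of an operation on `MSE_n(R)`:
`[(b, a₂, …, a_n)] * [(a, a₂, …, a_n)] = [(a b, a₂, …, a_n)]`. -/
def IsNice (op : MSE n R → MSE n R → MSE n R) : Prop :=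
  ∀ v w : Um n R, (∀ j, j ≠ 0 → w.1 j = v.1 j) →
    ∃ h : IsUnimodular (Function.update v.1 0 (v.1 0 * w.1 0)),
      op (MSE.mk w) (MSE.mk v) = MSE.mk ⟨Function.update v.1 0 (v.1 0 * w.1 0), h⟩

/-- Niceness of an operation on `MSE_n(R, I)`: for every coordinate `i`,
`[(a₁, …, b, …, a_n)] * [(a₁, …, a, …, a_n)] = [(a₁, …, a b, …, a_n)]`, where `b`, `a`, `a b` are
the `i`-th entries. For the operations given by the Vaserstein–van der Kallen rule it is equivalent
to ask this for the first coordinate only, or for the last only; here all are required. -/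
def IsNiceRel {I : Ideal R} (op : MSERel n R I → MSERel n R I → MSERel n R I) : Prop :=
  ∀ (i : Fin n) (v w : UmRel n R I), (∀ j, j ≠ i → w.1 j = v.1 j) →
    ∃ u : UmRel n R I, u.1 = Function.update v.1 i (v.1 i * w.1 i) ∧
      op (MSERel.mk w) (MSERel.mk v) = MSERel.mk u

end rules

/-!
Lifting a row congruent to `e₁` modulo `I` to the row congruent to `e₁` modulo `0 ⊕ I` defines a map
`φ : MSE_n(R, I) → MSE_n(R ⊕ I)`. The only class with the same image as that of `e₁` is the class of
`e₁`: a matrix of `E_n(R ⊕ I)` taking a lifted row to `e₁` becomes relative elementary after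
correction by its image under the projection `R ⊕ I → R`, and this image fixes `e₁`. Moreover `φ` is
multiplicative on classes with representatives which agree outside the first coordinate, because
there the same formula computes both products.

If `v` and `w` agree outside the `i`-th coordinate and `u` is the row claimed to represent `[w] *
[v]`, then niceness of `MSE_n(R ⊕ I)` gives `φ([w] * [v]) = φ[u]` and an inverse `φ[c]` of `φ[u]`,
where `c` differs from `u` only in the `i`-th coordinate. The class `[c]` has common tails with both
`[w] * [v]` and `[u]`, so `[c] * ([w] * [v])` and `[c] * [u]` are sent to `1` by `φ`. Both are
therefore equal to `1`, and `[c]` cancels.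

That the rule on `MSE_n(ℤ ⊕ I)` can be read on relative rows of `R` depends on `ℤ` being Euclidean:
a matrix of determinant `1` over `ℤ` fixing `e₁` is a product of elementary matrices fixing `e₁`,
and these preserve the class of every relative row.
-/

section ElementaryMatrices

open scoped commutatorElement

variable {ι A : Type*} [Fintype ι] [DecidableEq ι] [CommRing A]

/-- The elementary matrix `E_{ij}(c)` as an element of the general linear group. -/
def elemGL {i j : ι} (hij : i ≠ j) (c : A) : GL ι A :=
  SpecialLinearGroup.toGL (SpecialLinearGroup.transvection hij c)

theorem coe_elemGL {i j : ι} (hij : i ≠ j) (c : A) :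
    (elemGL hij c : Matrix ι ι A) = transvection i j c := rfl

theorem elemGL_add {i j : ι} (hij : i ≠ j) (b c : A) :
    elemGL hij (b + c) = elemGL hij b * elemGL hij c := by
  rw [elemGL, SpecialLinearGroup.transvection_add, map_mul]; rfl

theorem elemGL_neg {i j : ι} (hij : i ≠ j) (c : A) : elemGL hij (-c) = (elemGL hij c)⁻¹ := by
  rw [elemGL, ← SpecialLinearGroup.transvection_inv, map_inv]; rfl

theorem commutatorElement_elemGL {i j k : ι} (hij : i ≠ j) (hjk : j ≠ k) (hik : i ≠ k) (b c : A) :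
    ⁅elemGL hij b, elemGL hjk c⁆ = elemGL hik (b * c) := by
  rw [commutatorElement_def, ← elemGL_neg, ← elemGL_neg]
  apply Units.ext
  simp only [Units.val_mul, coe_elemGL, transvection, add_mul, mul_add, one_mul, mul_one,
    single_mul_single_same, ne_eq, hij.symm, hjk.symm, hik.symm, not_false_eq_true,
    single_mul_single_of_ne, add_zero, mul_neg, neg_mul, ← single_neg]
  abel

theorem vecMul_elemGL {i j : ι} (hij : i ≠ j) (c : A) (v : ι → A) :
    v ᵥ* (elemGL hij c).1 = Function.update v j (v j + c * v i) := by
  rw [coe_elemGL, transvection, vecMul_add, vecMul_one]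
  ext k
  obtain rfl | hk := eq_or_ne k j
  · simp [vecMul, dotProduct, single_apply, mul_comm]
  · simp [vecMul, dotProduct, hk, hk.symm]

theorem vecMul_eq_iff_eq_vecMul_inv {g : GL ι A} {v w : ι → A} :
    v ᵥ* g.1 = w ↔ v = w ᵥ* (g⁻¹).1 := by
  constructor <;> rintro rfl <;> rw [vecMul_vecMul, ← Units.val_mul] <;> simp

theorem vecMul_dotProduct_inv_mulVec (g : GL ι A) (v w : ι → A) :
    (v ᵥ* g.1) ⬝ᵥ ((g⁻¹).1 *ᵥ w) = v ⬝ᵥ w := by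
  rw [dotProduct_mulVec, vecMul_vecMul, ← Units.val_mul, mul_inv_cancel, Units.val_one, vecMul_one]

/-- The subgroup of the general linear group generated by the elementary matrices `E_{ij}(c)` with
`i ∈ s`, that is, by the operations adding multiples of the columns in `s` to other columns. -/
def elemGroupOn (s : Set ι) (A : Type*) [CommRing A] : Subgroup (GL ι A) :=
  Subgroup.closure {g | ∃ (i j : ι) (hij : i ≠ j) (c : A), i ∈ s ∧ g = elemGL hij c}

theorem elemGL_mem_elemGroupOn {s : Set ι} {i j : ι} (hij : i ≠ j) (hi : i ∈ s) (c : A) :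
    elemGL hij c ∈ elemGroupOn s A :=
  Subgroup.subset_closure ⟨i, j, hij, c, hi, rfl⟩

theorem elemGroupOn_mono {s t : Set ι} (hst : s ⊆ t) : elemGroupOn s A ≤ elemGroupOn t A := by
  refine Subgroup.closure_mono ?_
  rintro _ ⟨i, j, hij, c, hi, rfl⟩
  exact ⟨i, j, hij, c, hst hi, rfl⟩

theorem det_eq_one_of_mem_elemGroupOn {s : Set ι} {g : GL ι A} (hg : g ∈ elemGroupOn s A) :
    GeneralLinearGroup.det g = 1 := by
  suffices elemGroupOn s A ≤ GeneralLinearGroup.det.ker from this hg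
  refine (Subgroup.closure_le _).2 ?_
  rintro _ ⟨i, j, hij, c, -, rfl⟩
  exact SpecialLinearGroup.coeToGL_det _

theorem single_vecMul_eq_of_mem_elemGroupOn {s : Set ι} {g : GL ι A} (hg : g ∈ elemGroupOn s A)
    {i : ι} (hi : i ∉ s) : Pi.single i 1 ᵥ* g.1 = Pi.single i 1 := by
  induction hg using Subgroup.closure_induction with
  | mem g hg =>
    obtain ⟨j, k, hjk, c, hj, rfl⟩ := hg
    have hij : j ≠ i := ne_of_mem_of_not_mem hj hi
    rw [vecMul_elemGL, Pi.single_eq_of_ne hij, mul_zero, add_zero, Function.update_eq_self]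
  | one => simp
  | mul g h _ _ ihg ihh => rw [Units.val_mul, ← vecMul_vecMul, ihg, ihh]
  | inv g _ ih => exact (vecMul_eq_iff_eq_vecMul_inv.1 ih).symm

theorem exists_vecMul_apply_eq_one_of_isUnit {s : Set ι} {r : ι → A} {i k : ι}
    (hik : i ≠ k) (hi : i ∈ s) (hr : IsUnit (r i)) :
    ∃ g ∈ elemGroupOn s A, (r ᵥ* g.1) k = 1 := by
  obtain ⟨u, hu⟩ := hr.exists_left_inv
  refine ⟨elemGL hik ((1 - r k) * u), elemGL_mem_elemGroupOn hik hi _, ?_⟩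
  rw [vecMul_elemGL, Function.update_self]
  linear_combination (1 - r k) * hu

theorem exists_vecMul_eq_single {s : Set ι} {k : ι} (hk : k ∈ s) {r : ι → A}
    (hr : r k = 1) : ∃ g ∈ elemGroupOn s A, r ᵥ* g.1 = Pi.single k 1 := by
  suffices ∀ t : Finset ι, ∃ g ∈ elemGroupOn s A, (r ᵥ* g.1) k = 1 ∧
      ∀ j ∈ t, j ≠ k → (r ᵥ* g.1) j = 0 by
    obtain ⟨g, hg, hone, hzero⟩ := this Finset.univ
    refine ⟨g, hg, funext fun j => ?_⟩
    obtain rfl | hjk := eq_or_ne j k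
    · simp [hone]
    · simp [hjk, hzero]
  intro t
  induction t using Finset.induction_on with
  | empty => exact ⟨1, one_mem _, by simpa, by simp⟩
  | insert j t _ ih =>
    obtain ⟨g, hg, hone, hzero⟩ := ih
    obtain rfl | hjk := eq_or_ne j k
    · exact ⟨g, hg, hone, by simpa using hzero⟩
    · refine ⟨g * elemGL hjk.symm (-(r ᵥ* g.1) j), mul_mem hg (elemGL_mem_elemGroupOn _ hk _), ?_⟩
      rw [Units.val_mul, ← vecMul_vecMul, vecMul_elemGL, hone]
      refine ⟨by rw [Function.update_of_ne hjk.symm, hone], fun i hi hik => ?_⟩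
      obtain rfl | hij := eq_or_ne i j
      · simp
      · rw [Function.update_of_ne hij]
        exact hzero i ((Finset.mem_insert.1 hi).resolve_left hij) hik

theorem apply_self_eq_det_of_single_vecMul_eq {M : Matrix ι ι A} {k : ι}
    (hM : ∀ i ≠ k, Pi.single i 1 ᵥ* M = Pi.single i 1) : M k k = M.det := by
  have hrow : M = (1 : Matrix ι ι A).updateRow k (M k) := by
    ext i j
    obtain rfl | hi := eq_or_ne i k
    · simp
    · simpa [hi, one_apply, Pi.single_apply, eq_comm] using congrFun (hM i hi) j
  rw [hrow, ← cramer_transpose_apply, transpose_one, cramer_one]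
  simp

end ElementaryMatrices

section EuclideanDomain

variable {ι A : Type*} [Fintype ι] [DecidableEq ι] [EuclideanDomain A] {s : Set ι}

theorem exists_isUnit_vecMul_apply {r d : ι → A} (hd : ∀ i ∉ s, d i = 0) (hrd : r ⬝ᵥ d = 1) :
    ∃ g ∈ elemGroupOn s A, ∃ i ∈ s, IsUnit ((r ᵥ* g.1) i) := by
  let S : Set A := {x | x ≠ 0 ∧ ∃ g ∈ elemGroupOn s A, ∃ i ∈ s, (r ᵥ* g.1) i = x}
  have hS : S.Nonempty := by
    obtain ⟨i, -, hi⟩ := Finset.exists_ne_zero_of_sum_ne_zero (hrd.trans_ne one_ne_zero)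
    exact ⟨r i, left_ne_zero_of_mul hi, 1, one_mem _, i,
      not_imp_comm.1 (hd i) (right_ne_zero_of_mul hi), by simp⟩
  obtain ⟨x, ⟨hx, g, hg, i, hi, hgi⟩, hmin⟩ := EuclideanDomain.r_wellFounded.has_min S hS
  refine ⟨g, hg, i, hi, ?_⟩
  rw [hgi]
  have hdvd : ∀ j ∈ s, x ∣ (r ᵥ* g.1) j := by
    intro j hj
    obtain rfl | hij := eq_or_ne i j
    · rw [hgi]
    by_contra hndvd
    let y := (r ᵥ* g.1) j
    refine hmin (y % x) ⟨mt EuclideanDomain.mod_eq_zero.1 hndvd,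
      g * elemGL hij (-(y / x)), mul_mem hg (elemGL_mem_elemGroupOn hij hi _), j, hj, ?_⟩
      (EuclideanDomain.mod_lt y hx)
    rw [Units.val_mul, ← vecMul_vecMul, vecMul_elemGL, Function.update_self, hgi,
      EuclideanDomain.mod_eq_sub_mul_div]
    ring
  rw [isUnit_iff_dvd_one, ← hrd, ← vecMul_dotProduct_inv_mulVec g]
  refine Finset.dvd_sum fun j _ => ?_
  by_cases hj : j ∈ s
  · exact (hdvd j hj).mul_right _
  · have hjd : ((g⁻¹).1 *ᵥ d) j = 0 := by
      have := congrArg (· ⬝ᵥ d) (single_vecMul_eq_of_mem_elemGroupOn (inv_mem hg) hj)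
      rw [← dotProduct_mulVec] at this
      simpa [hd j hj] using this
    rw [hjd, mul_zero]
    exact dvd_zero x

theorem exists_vecMul_apply_eq_one (hs : s.Nontrivial) {k : ι} (hk : k ∈ s) {r d : ι → A}
    (hd : ∀ i ∉ s, d i = 0) (hrd : r ⬝ᵥ d = 1) :
    ∃ g ∈ elemGroupOn s A, (r ᵥ* g.1) k = 1 := by
  obtain ⟨g, hg, i, hi, hunit⟩ := exists_isUnit_vecMul_apply hd hrd
  obtain ⟨g, hg, i, hik, hi, hunit⟩ :
      ∃ g ∈ elemGroupOn s A, ∃ i ≠ k, i ∈ s ∧ IsUnit ((r ᵥ* g.1) i) := by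
    obtain hik | rfl := ne_or_eq i k
    · exact ⟨g, hg, i, hik, hi, hunit⟩
    · obtain ⟨j, hj, hji⟩ := hs.exists_ne i
      obtain ⟨h, hh, hone⟩ := exists_vecMul_apply_eq_one_of_isUnit hji.symm hi hunit
      refine ⟨g * h, mul_mem hg hh, j, hji, hj, ?_⟩
      rw [Units.val_mul, ← vecMul_vecMul, hone]
      exact isUnit_one
  obtain ⟨h, hh, hone⟩ := exists_vecMul_apply_eq_one_of_isUnit hik hi hunit
  exact ⟨g * h, mul_mem hg hh, by rwa [Units.val_mul, ← vecMul_vecMul]⟩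

theorem mem_elemGroupOn_of_det_eq_one {g : GL ι A} (hdet : GeneralLinearGroup.det g = 1)
    (hfix : ∀ i ∉ s, Pi.single i 1 ᵥ* g.1 = Pi.single i 1) : g ∈ elemGroupOn s A := by
  induction s, s.toFinite using Set.Finite.induction_on generalizing g with
  | empty =>
    have : g = 1 := Units.ext (Matrix.ext_of_single_vecMul fun i => by simp [hfix i])
    exact this ▸ one_mem _
  | @insert k s hk _ ih =>
    obtain ⟨g₁, hg₁, hone⟩ : ∃ h ∈ elemGroupOn (insert k s) A,
        (Pi.single k 1 ᵥ* g.1 ᵥ* h.1) k = 1 := by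
      obtain rfl | hs := s.eq_empty_or_nonempty
      · refine ⟨1, one_mem _, ?_⟩
        have := apply_self_eq_det_of_single_vecMul_eq (M := g.1) (k := k) (by simpa using hfix)
        simpa [this] using congrArg Units.val hdet
      · have hnontrivial : (insert k s).Nontrivial :=
          let ⟨i, hi⟩ := hs
          ⟨k, Set.mem_insert k s, i, Set.mem_insert_of_mem k hi, (ne_of_mem_of_not_mem hi hk).symm⟩
        refine exists_vecMul_apply_eq_one (d := (g⁻¹).1 *ᵥ Pi.single k 1) hnontrivial
          (Set.mem_insert k s) (fun i hi => ?_) ?_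
        · have hsingle := (vecMul_eq_iff_eq_vecMul_inv.1 (hfix i hi)).symm
          have hik : i ≠ k := fun h => hi (h ▸ Set.mem_insert i s)
          simpa [← dotProduct_mulVec, hik.symm] using congrArg (· ⬝ᵥ Pi.single k 1) hsingle
        · rw [vecMul_dotProduct_inv_mulVec]
          simp
    obtain ⟨g₂, hg₂, hsingle⟩ := exists_vecMul_eq_single (Set.mem_insert k s) hone
    have hg₁₂ := mul_mem hg₁ hg₂
    refine (mul_mem_cancel_right hg₁₂).1 (elemGroupOn_mono (Set.subset_insert k s) (ih ?_ ?_))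
    · rw [map_mul, hdet, det_eq_one_of_mem_elemGroupOn hg₁₂, one_mul]
    · intro i hi
      obtain rfl | hik := eq_or_ne i k
      · rw [Units.val_mul, Units.val_mul, ← vecMul_vecMul, ← vecMul_vecMul, hsingle]
      · have hi : i ∉ insert k s := by simp [hi, hik]
        rw [Units.val_mul, ← vecMul_vecMul, hfix i hi,
          single_vecMul_eq_of_mem_elemGroupOn hg₁₂ hi]

end EuclideanDomain

section RelativeElementaryGroup

open scoped commutatorElement

variable {n : ℕ} {A B : Type*} [CommRing A] [CommRing B]

theorem map_elemGL (f : A →+* B) {i j : Fin n} (hij : i ≠ j) (c : A) :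
    GeneralLinearGroup.map f (elemGL hij c) = elemGL hij (f c) :=
  Units.ext (map_transvection_val f i j c)

theorem map_mem_elemGroupOn (f : A →+* B) {s : Set (Fin n)} {g : GL (Fin n) A}
    (hg : g ∈ elemGroupOn s A) : GeneralLinearGroup.map f g ∈ elemGroupOn s B := by
  suffices elemGroupOn s A ≤ (elemGroupOn s B).comap (GeneralLinearGroup.map f) from this hg
  refine (Subgroup.closure_le _).2 ?_
  rintro _ ⟨i, j, hij, c, hi, rfl⟩
  rw [SetLike.mem_coe, Subgroup.mem_comap, map_elemGL]
  exact elemGL_mem_elemGroupOn hij hi (f c)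

theorem elemGroup_eq_elemGroupOn_univ : elemGroup n A = elemGroupOn Set.univ A := by
  unfold elemGroup elemGroupOn
  congr 1
  ext g
  constructor
  · rintro ⟨i, j, hij, c, hg⟩
    exact ⟨i, j, hij, c, Set.mem_univ i, Units.ext hg⟩
  · rintro ⟨i, j, hij, c, -, rfl⟩
    exact ⟨i, j, hij, c, rfl⟩

theorem elemGL_mem_elemGroup {i j : Fin n} (hij : i ≠ j) (c : A) : elemGL hij c ∈ elemGroup n A :=
  Subgroup.subset_closure ⟨i, j, hij, c, rfl⟩

variable [NeZero n] {I : Ideal A} {J : Ideal B}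

theorem elemGroupRel_le_elemGroup : elemGroupRel n A I ≤ elemGroup n A := by
  rintro _ ⟨g, -, rfl⟩
  exact g.2

theorem conj_mem_elemGroupRel {g h : GL (Fin n) A} (hg : g ∈ elemGroup n A)
    (hh : h ∈ elemGroupRel n A I) : g * h * g⁻¹ ∈ elemGroupRel n A I := by
  obtain ⟨k, hk, rfl⟩ := hh
  exact ⟨⟨g, hg⟩ * k * ⟨g, hg⟩⁻¹, Subgroup.normalClosure_normal.conj_mem k hk _, by simp⟩

theorem commutatorElement_mem_elemGroupRel_left {g h : GL (Fin n) A}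
    (hg : g ∈ elemGroupRel n A I) (hh : h ∈ elemGroup n A) : ⁅g, h⁆ ∈ elemGroupRel n A I := by
  simpa only [commutatorElement_def, mul_assoc] using
    mul_mem hg (conj_mem_elemGroupRel hh (inv_mem hg))

theorem commutatorElement_mem_elemGroupRel_right {g h : GL (Fin n) A}
    (hg : g ∈ elemGroup n A) (hh : h ∈ elemGroupRel n A I) : ⁅g, h⁆ ∈ elemGroupRel n A I :=
  mul_mem (conj_mem_elemGroupRel hg hh) (inv_mem hh)

theorem elemGL_mem_elemGroupRel_of_same_row {i j k : Fin n} (hij : i ≠ j) (hik : i ≠ k) {x : A}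
    (hx : elemGL hij x ∈ elemGroupRel n A I) : elemGL hik x ∈ elemGroupRel n A I := by
  obtain rfl | hjk := eq_or_ne j k
  · exact hx
  · simpa [commutatorElement_elemGL hij hjk hik] using
      commutatorElement_mem_elemGroupRel_left hx (elemGL_mem_elemGroup hjk 1)

theorem elemGL_mem_elemGroupRel_of_same_column {i j k : Fin n} (hik : i ≠ k) (hjk : j ≠ k) {x : A}
    (hx : elemGL hik x ∈ elemGroupRel n A I) : elemGL hjk x ∈ elemGroupRel n A I := by
  obtain rfl | hji := eq_or_ne j i
  · exact hx
  · simpa [commutatorElement_elemGL hji hik hjk] using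
      commutatorElement_mem_elemGroupRel_right (elemGL_mem_elemGroup hji 1) hx

theorem fin_one_ne_zero (hn : 3 ≤ n) : (1 : Fin n) ≠ 0 := by
  obtain ⟨m, rfl⟩ := Nat.exists_eq_add_of_le' hn
  simp

theorem elemGL_mem_elemGroupRel (hn : 3 ≤ n) {i j : Fin n} (hij : i ≠ j) {x : A} (hx : x ∈ I) :
    elemGL hij x ∈ elemGroupRel n A I := by
  have h10 := fin_one_ne_zero hn
  have hbase : elemGL h10 x ∈ elemGroupRel n A I :=
    ⟨⟨_, elemGL_mem_elemGroup h10 x⟩, Subgroup.subset_normalClosure ⟨x, hx, rfl⟩, rfl⟩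
  obtain rfl | hj1 := eq_or_ne j 1
  · obtain ⟨k, hki, hk1⟩ := Fin.exists_ne_and_ne_of_two_lt i 1 hn
    exact elemGL_mem_elemGroupRel_of_same_row hki.symm hij
      (elemGL_mem_elemGroupRel_of_same_column hk1.symm hki.symm
        (elemGL_mem_elemGroupRel_of_same_row h10 hk1.symm hbase))
  · exact elemGL_mem_elemGroupRel_of_same_column hj1.symm hij
      (elemGL_mem_elemGroupRel_of_same_row h10 hj1.symm hbase)

theorem elemGroupRel_le (hn : 3 ≤ n) {H : Subgroup (GL (Fin n) A)}
    (hconj : ∀ g ∈ elemGroup n A, ∀ h ∈ H, g * h * g⁻¹ ∈ H)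
    (hmem : ∀ x ∈ I, ∀ (i j : Fin n) (hij : i ≠ j), elemGL hij x ∈ H) : elemGroupRel n A I ≤ H := by
  have hnormal : (H.comap (elemGroup n A).subtype).Normal := ⟨fun h hh g => hconj g g.2 h hh⟩
  refine Subgroup.map_le_iff_le_comap.2 (Subgroup.normalClosure_le_normal ?_)
  rintro g ⟨x, hx, hg⟩
  have hg : (g : GL (Fin n) A) = elemGL (fin_one_ne_zero hn) x := Units.ext hg
  exact Subgroup.mem_subgroupOf.2 (hg ▸ hmem x hx 1 0 (fin_one_ne_zero hn))

theorem map_mul_map_inv_mem_elemGroupRel (hn : 3 ≤ n) {f₁ f₂ : A →+* B}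
    (hf : ∀ x, f₁ x - f₂ x ∈ J) {g : GL (Fin n) A} (hg : g ∈ elemGroup n A) :
    GeneralLinearGroup.map f₁ g * (GeneralLinearGroup.map f₂ g)⁻¹ ∈ elemGroupRel n B J := by
  induction hg using Subgroup.closure_induction with
  | mem g hg =>
    obtain ⟨i, j, hij, c, hc⟩ := hg
    obtain rfl : g = elemGL hij c := Units.ext hc
    rw [map_elemGL, map_elemGL, ← elemGL_neg, ← elemGL_add, ← sub_eq_add_neg]
    exact elemGL_mem_elemGroupRel hn hij (hf c)
  | one => simp [one_mem]
  | mul g h hg _ ihg ihh =>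
    have hg₁ := elemGroup_map f₁ hg
    simpa [mul_assoc] using mul_mem (conj_mem_elemGroupRel hg₁ ihh) ihg
  | inv g hg ih =>
    have hg₁ := elemGroup_map f₁ hg
    simpa [mul_assoc] using conj_mem_elemGroupRel (inv_mem hg₁) (inv_mem ih)

end RelativeElementaryGroup

section Rows

variable {n : ℕ} {A B : Type*} [CommRing A] [CommRing B]

theorem comp_vecMul (f : A →+* B) (v : Fin n → A) (g : GL (Fin n) A) :
    f ∘ (v ᵥ* g.1) = (f ∘ v) ᵥ* (GeneralLinearGroup.map f g).1 :=
  funext fun j => RingHom.map_vecMul f g.1 v j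

theorem comp_single_one (f : A →+* B) (i : Fin n) :
    f ∘ (Pi.single i 1 : Fin n → A) = Pi.single i 1 := by
  rw [Pi.single, Function.comp_update, map_one]
  congr 1
  exact funext fun _ => map_zero f

theorem IsUnimodular.vecMul {v : Fin n → A} (hv : IsUnimodular v) (g : GL (Fin n) A) :
    IsUnimodular (v ᵥ* g.1) := by
  obtain ⟨w, hw⟩ := hv
  exact ⟨(g⁻¹).1 *ᵥ w, by rw [vecMul_dotProduct_inv_mulVec, hw]⟩

/-- Two rows lie in the same orbit of a subgroup `H` of `GL_n(A)`: the relation underlying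
`rowSetoid H`, without the restriction to a set of rows. -/
def RowEquiv (H : Subgroup (GL (Fin n) A)) (v w : Fin n → A) : Prop :=
  ∃ g ∈ H, v ᵥ* g.1 = w

namespace RowEquiv

variable {H K : Subgroup (GL (Fin n) A)} {u v w : Fin n → A}

theorem refl (v : Fin n → A) : RowEquiv H v v :=
  ⟨1, one_mem H, by simp⟩

theorem symm : RowEquiv H v w → RowEquiv H w v := by
  rintro ⟨g, hg, h⟩
  exact ⟨g⁻¹, inv_mem hg, (vecMul_eq_iff_eq_vecMul_inv.1 h).symm⟩

theorem trans : RowEquiv H u v → RowEquiv H v w → RowEquiv H u w := by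
  rintro ⟨g, hg, rfl⟩ ⟨h, hh, rfl⟩
  exact ⟨g * h, mul_mem hg hh, by rw [Units.val_mul, vecMul_vecMul]⟩

theorem mono (hHK : H ≤ K) : RowEquiv H v w → RowEquiv K v w := by
  rintro ⟨g, hg, h⟩
  exact ⟨g, hHK hg, h⟩

theorem isUnimodular (h : RowEquiv H v w) (hv : IsUnimodular v) : IsUnimodular w := by
  obtain ⟨g, -, rfl⟩ := h
  exact hv.vecMul g

end RowEquiv

theorem MSE.mk_eq_iff {v w : Um n A} :
    MSE.mk v = MSE.mk w ↔ RowEquiv (elemGroup n A) v.1 w.1 :=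
  Quotient.eq

/-- The ideal generated by the entries of a row other than the `i`-th one. -/
abbrev idealOff (v : Fin n → A) (i : Fin n) : Ideal A :=
  Ideal.span {x | ∃ j, j ≠ i ∧ x = v j}

theorem idealOff_congr {v w : Fin n → A} {i : Fin n} (h : ∀ j, j ≠ i → w j = v j) :
    idealOff w i = idealOff v i := by
  refine congrArg Ideal.span (Set.ext fun x => ?_)
  exact exists_congr fun j => and_congr_right fun hj => by rw [h j hj]

theorem mul_sub_one_mem_idealOff {v d : Fin n → A} (h : v ⬝ᵥ d = 1) (i : Fin n) :
    v i * d i - 1 ∈ idealOff v i := by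
  have hsum : v i * d i - 1 = -∑ j ∈ Finset.univ.erase i, v j * d j := by
    rw [← h, dotProduct, ← Finset.add_sum_erase _ _ (Finset.mem_univ i)]
    ring
  rw [hsum]
  refine neg_mem (Ideal.sum_mem _ fun j hj => Ideal.mul_mem_right _ _ (Ideal.subset_span ?_))
  exact ⟨j, Finset.ne_of_mem_erase hj, rfl⟩

variable [NeZero n] {I : Ideal A}

theorem MSERel.mk_eq_iff {v w : UmRel n A I} :
    MSERel.mk v = MSERel.mk w ↔ RowEquiv (elemGroupRel n A I) v.1 w.1 :=
  Quotient.eq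

theorem MSERel.exists_rep (x : MSERel n A I) : ∃ v : UmRel n A I, MSERel.mk v = x :=
  Quotient.exists_rep x

theorem RowEquiv.vecMul {v w : Fin n → A} (h : RowEquiv (elemGroupRel n A I) v w)
    {k : GL (Fin n) A} (hk : k ∈ elemGroup n A) :
    RowEquiv (elemGroupRel n A I) (v ᵥ* k.1) (w ᵥ* k.1) := by
  obtain ⟨g, hg, rfl⟩ := h
  refine ⟨k⁻¹ * g * k, by simpa using conj_mem_elemGroupRel (inv_mem hk) hg, ?_⟩
  simp only [vecMul_vecMul, ← Units.val_mul]
  group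

theorem rowEquiv_update (hn : 3 ≤ n) {i j : Fin n} (hij : i ≠ j) {x : A} (hx : x ∈ I)
    (v : Fin n → A) : RowEquiv (elemGroupRel n A I) v (Function.update v j (v j + x * v i)) :=
  ⟨elemGL hij x, elemGL_mem_elemGroupRel hn hij hx, vecMul_elemGL hij x v⟩

theorem rowEquiv_update_of_mem_idealOff (hn : 3 ≤ n) {v : Fin n → A} {i : Fin n} {d m : A}
    (hd : d ∈ idealOff v i) (hm : m ∈ I) :
    RowEquiv (elemGroupRel n A I) v (Function.update v i (v i + d * m)) := by
  suffices ∀ m ∈ I, ∀ c, RowEquiv (elemGroupRel n A I) (Function.update v i c)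
      (Function.update v i (c + d * m)) by simpa using this m hm (v i)
  induction hd using Submodule.span_induction with
  | mem x hx =>
    obtain ⟨j, hj, rfl⟩ := hx
    intro m hm c
    simpa [hj, mul_comm] using rowEquiv_update hn hj hm (Function.update v i c)
  | zero => simp [RowEquiv.refl]
  | add x y _ _ hx hy =>
    intro m hm c
    simpa [add_mul, add_assoc] using (hx m hm c).trans (hy m hm _)
  | smul r x _ hx =>
    intro m hm c
    simpa [mul_left_comm, mul_assoc] using hx (r * m) (I.mul_mem_left r hm) c

end Rows

section RelativeRows

variable {n : ℕ} [NeZero n] {A B : Type*} [CommRing A] [CommRing B] {I : Ideal A} {J : Ideal B}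

/-- A row is congruent to `e₁` modulo `I`; this is the second half of the condition defining
`UmRel`. -/
def IsRelRow (I : Ideal A) (v : Fin n → A) : Prop :=
  v 0 - 1 ∈ I ∧ ∀ j, j ≠ 0 → v j ∈ I

theorem isRelRow_iff {v : Fin n → A} :
    IsRelRow I v ↔ ∀ j, v j - (Pi.single 0 1 : Fin n → A) j ∈ I := by
  refine ⟨fun ⟨h₀, h⟩ j => ?_, fun h => ⟨by simpa using h 0, fun j hj => by simpa [hj] using h j⟩⟩
  obtain rfl | hj := eq_or_ne j 0
  · simpa using h₀
  · simpa [hj] using h j hj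

theorem isRelRow_ker_iff {π : A →+* B} {v : Fin n → A} :
    IsRelRow (RingHom.ker π) v ↔ π ∘ v = Pi.single 0 1 := by
  simp only [isRelRow_iff, RingHom.mem_ker, map_sub, sub_eq_zero, ← comp_single_one π, funext_iff,
    Function.comp_apply]

theorem isRelRow_iff_mk_comp {v : Fin n → A} :
    IsRelRow I v ↔ Ideal.Quotient.mk I ∘ v = Pi.single 0 1 := by
  rw [← isRelRow_ker_iff, Ideal.mk_ker]

theorem UmRel.isRelRow (v : UmRel n A I) : IsRelRow I v.1 :=
  v.2.2

namespace IsRelRow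

variable {v w : Fin n → A}

theorem map (hv : IsRelRow I v) (f : A →+* B) (hf : ∀ x ∈ I, f x ∈ J) : IsRelRow J (f ∘ v) :=
  ⟨by simpa using hf _ hv.1, fun j hj => hf _ (hv.2 j hj)⟩

theorem update (hv : IsRelRow I v) {i : Fin n} {x : A}
    (hx : x - (Pi.single 0 1 : Fin n → A) i ∈ I) : IsRelRow I (Function.update v i x) := by
  rw [isRelRow_iff] at hv ⊢
  intro j
  obtain rfl | hj := eq_or_ne j i
  · simpa using hx
  · simpa [hj] using hv j

theorem mul_apply (hv : IsRelRow I v) (hw : IsRelRow I w) (i : Fin n) :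
    v i * w i - (Pi.single 0 1 : Fin n → A) i ∈ I := by
  obtain rfl | hi := eq_or_ne i 0
  · have := I.add_mem (I.mul_mem_left (v 0) hw.1) hv.1
    rwa [mul_sub, mul_one, sub_add_sub_cancel, ← Pi.single_eq_same (M := fun _ => A) 0 1] at this
  · simpa [hi] using I.mul_mem_left (v i) (hw.2 i hi)

theorem vecMul (hv : IsRelRow I v) {g : GL (Fin n) A} (hg : g ∈ elemGroupOn {0}ᶜ A) :
    IsRelRow I (v ᵥ* g.1) := by
  rw [isRelRow_iff_mk_comp] at hv ⊢
  rw [comp_vecMul, hv]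
  exact single_vecMul_eq_of_mem_elemGroupOn (map_mem_elemGroupOn _ hg) (by simp)

theorem rowEquiv_vecMul_elemGL_of_ne (hn : 3 ≤ n) (hv : IsRelRow I v) {i j : Fin n} (hij : i ≠ j)
    (hi : i ≠ 0) (hj : j ≠ 0) (c : A) :
    RowEquiv (elemGroupRel n A I) v (v ᵥ* (elemGL hij c).1) := by
  have h₁ := rowEquiv_update hn hj.symm (I.mul_mem_left c (hv.2 i hi)) v
  have h₂ := rowEquiv_update hn hij (I.mul_mem_left (-c) hv.1)
    (Function.update v j (v j + c * v i * v 0))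
  convert h₁.trans h₂ using 1
  rw [vecMul_elemGL, Function.update_self, Function.update_of_ne hij, Function.update_idem]
  congr 1
  ring

theorem rowEquiv_vecMul_elemGL (hn : 3 ≤ n) (hv : IsRelRow I v) {i j : Fin n} (hij : i ≠ j)
    (hi : i ≠ 0) (c : A) : RowEquiv (elemGroupRel n A I) v (v ᵥ* (elemGL hij c).1) := by
  obtain rfl | hj := eq_or_ne j 0
  · obtain ⟨k, hki, hk0⟩ := Fin.exists_ne_and_ne_of_two_lt i 0 hn
    have h₁ := hv.rowEquiv_vecMul_elemGL_of_ne hn hki.symm hi hk0 c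
    have hrel : IsRelRow I (v ᵥ* (elemGL hki.symm c).1 ᵥ* (elemGL hk0 1).1) :=
      (hv.vecMul (elemGL_mem_elemGroupOn hki.symm (by simpa using hi) c)).vecMul
        (elemGL_mem_elemGroupOn hk0 (by simpa using hk0) 1)
    have h₂ := (hrel.rowEquiv_vecMul_elemGL_of_ne hn hki.symm hi hk0 (-c)).vecMul
      (inv_mem (elemGL_mem_elemGroup hk0 1))
    rw [← vecMul_eq_iff_eq_vecMul_inv.1 rfl] at h₂
    rw [← mul_one c, ← commutatorElement_elemGL hki.symm hk0 hij c 1, commutatorElement_def,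
      ← elemGL_neg hki.symm]
    simpa only [Units.val_mul, ← vecMul_vecMul] using h₁.trans h₂
  · exact hv.rowEquiv_vecMul_elemGL_of_ne hn hij hi hj c

theorem rowEquiv_vecMul (hn : 3 ≤ n) (hv : IsRelRow I v) {g : GL (Fin n) A}
    (hg : g ∈ elemGroupOn {0}ᶜ A) : RowEquiv (elemGroupRel n A I) v (v ᵥ* g.1) := by
  induction hg using Subgroup.closure_induction generalizing v with
  | mem g hg =>
    obtain ⟨i, j, hij, c, hi, rfl⟩ := hg
    exact hv.rowEquiv_vecMul_elemGL hn hij hi c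
  | one => simpa using RowEquiv.refl v
  | mul g h hg _ ihg ihh =>
    rw [Units.val_mul, ← vecMul_vecMul]
    exact (ihg hv).trans (ihh (hv.vecMul hg))
  | inv g hg ih =>
    have h := ih (hv.vecMul (inv_mem hg))
    rw [vecMul_eq_iff_eq_vecMul_inv.2 rfl] at h
    exact h.symm

theorem exists_isRelRow_dotProduct_eq_one (hv : IsRelRow I v) (hu : IsUnimodular v) :
    ∃ d, IsRelRow I d ∧ v ⬝ᵥ d = 1 := by
  obtain ⟨w, hw⟩ := hu
  have h0 : 1 - v 0 ∈ I := sub_mem_comm_iff.1 hv.1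
  refine ⟨Pi.single 0 1 + (1 - v 0) • w, isRelRow_iff.2 fun j => ?_, ?_⟩
  · simpa using I.mul_mem_right (w j) h0
  · rw [dotProduct_add, dotProduct_smul, hw]
    simp

end IsRelRow

end RelativeRows

section Excision

variable {n : ℕ} [NeZero n] {T R : Type*} [CommRing T] [CommRing R] {K : Ideal T} {I : Ideal R}
  {f : T →+* R}

theorem IsRelRow.apply_eq_of_map_eq (hf : Set.InjOn f K) {v w : Fin n → T} (hv : IsRelRow K v)
    (hw : IsRelRow K w) {j : Fin n} (h : f (v j) = f (w j)) : v j = w j :=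
  sub_left_inj.1 (hf (isRelRow_iff.1 hv j) (isRelRow_iff.1 hw j) (by rw [map_sub, map_sub, h]))

theorem IsRelRow.eq_of_comp_eq (hf : Set.InjOn f K) {v w : Fin n → T} (hv : IsRelRow K v)
    (hw : IsRelRow K w) (h : f ∘ v = f ∘ w) : v = w :=
  funext fun j => hv.apply_eq_of_map_eq hf hw (congrFun h j)

theorem IsRelRow.exists_comp_eq (hf : Set.SurjOn f K I) {v : Fin n → R} (hv : IsRelRow I v) :
    ∃ V : Fin n → T, IsRelRow K V ∧ f ∘ V = v := by
  choose y hyK hy using fun j => hf (isRelRow_iff.1 hv j)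
  refine ⟨Pi.single 0 1 + y, isRelRow_iff.2 fun j => by simpa using hyK j, funext fun j => ?_⟩
  have hsingle := congrFun (comp_single_one f (0 : Fin n)) j
  simp_all

theorem IsRelRow.dotProduct_sub_one_mem {v w : Fin n → R} (hv : IsRelRow I v)
    (hw : IsRelRow I w) : v ⬝ᵥ w - 1 ∈ I := by
  rw [isRelRow_iff_mk_comp] at hv hw
  rw [← Ideal.Quotient.mk_eq_mk_iff_sub_mem, RingHom.map_dotProduct, hv, hw]
  simp

theorem IsRelRow.dotProduct_eq_one (hf : Set.InjOn f K) {v d : Fin n → T} (hv : IsRelRow K v)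
    (hd : IsRelRow K d) (h : (f ∘ v) ⬝ᵥ (f ∘ d) = 1) : v ⬝ᵥ d = 1 := by
  refine sub_eq_zero.1 (hf (hv.dotProduct_sub_one_mem hd) K.zero_mem ?_)
  rw [map_sub, RingHom.map_dotProduct, h, map_one, map_zero, sub_self]

/-- The map `Um_n(T, K) → Um_n(R, I)` inducing `MSERel.map`. -/
def UmRel.map (f : T →+* R) (hf : ∀ x ∈ K, f x ∈ I) (v : UmRel n T K) : UmRel n R I :=
  ⟨f ∘ v.1, v.2.1.map f, v.isRelRow.map f hf⟩

theorem UmRel.exists_dual (v : UmRel n R I) : ∃ d : UmRel n R I, v.1 ⬝ᵥ d.1 = 1 := by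
  obtain ⟨d, hd, hvd⟩ := v.isRelRow.exists_isRelRow_dotProduct_eq_one v.2.1
  exact ⟨⟨d, ⟨v.1, by rwa [dotProduct_comm]⟩, hd⟩, hvd⟩

theorem UmRel.map_surjective (hf : Set.BijOn f K I) :
    Function.Surjective (UmRel.map f hf.mapsTo : UmRel n T K → UmRel n R I) := by
  intro v
  obtain ⟨d, hvd⟩ := v.exists_dual
  obtain ⟨V, hV, hfV⟩ := v.isRelRow.exists_comp_eq hf.surjOn
  obtain ⟨D, hD, hfD⟩ := d.isRelRow.exists_comp_eq hf.surjOn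
  have hdual : V ⬝ᵥ D = 1 := hV.dotProduct_eq_one hf.injOn hD (by rw [hfV, hfD, hvd])
  exact ⟨⟨V, ⟨D, hdual⟩, hV⟩, Subtype.ext hfV⟩

theorem elemGroupRel_le_map (hn : 3 ≤ n) (hf : Set.SurjOn f K I) {σ : R →+* T}
    (hσ : f.comp σ = RingHom.id R) :
    elemGroupRel n R I ≤ (elemGroupRel n T K).map (GeneralLinearGroup.map f) := by
  refine elemGroupRel_le hn ?_ fun x hx i j hij => ?_
  · rintro g hg _ ⟨h, hh, rfl⟩
    refine ⟨_, conj_mem_elemGroupRel (elemGroup_map σ hg) hh, ?_⟩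
    rw [map_mul, map_mul, map_inv, ← MonoidHom.comp_apply, ← GeneralLinearGroup.map_comp, hσ]
    simp
  · obtain ⟨y, hy, rfl⟩ := hf hx
    exact ⟨_, elemGL_mem_elemGroupRel hn hij hy, map_elemGL f hij y⟩

theorem map_mk_eq_one_of_mem_elemGroupRel (hn : 3 ≤ n) {g : GL (Fin n) R}
    (hg : g ∈ elemGroupRel n R I) : GeneralLinearGroup.map (Ideal.Quotient.mk I) g = 1 := by
  suffices elemGroupRel n R I ≤ (GeneralLinearGroup.map (Ideal.Quotient.mk I)).ker from this hg
  refine elemGroupRel_le hn (fun g _ h hh => MonoidHom.normal_ker _ |>.conj_mem h hh g) ?_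
  intro x hx i j hij
  rw [MonoidHom.mem_ker, map_elemGL, Ideal.Quotient.eq_zero_iff_mem.2 hx]
  exact Units.ext (transvection_zero i j)

theorem IsRelRow.of_rowEquiv (hn : 3 ≤ n) {v w : Fin n → R} (hv : IsRelRow I v)
    (h : RowEquiv (elemGroupRel n R I) v w) : IsRelRow I w := by
  obtain ⟨g, hg, rfl⟩ := h
  rw [isRelRow_iff_mk_comp] at hv ⊢
  rw [comp_vecMul, map_mk_eq_one_of_mem_elemGroupRel hn hg, hv, Units.val_one, vecMul_one]

theorem MSERel.map_bijective (hn : 3 ≤ n) (hf : Set.BijOn f K I) {σ : R →+* T}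
    (hσ : f.comp σ = RingHom.id R) :
    Function.Bijective (MSERel.map f hf.mapsTo : MSERel n T K → MSERel n R I) := by
  refine ⟨fun x y hxy => ?_, fun x => ?_⟩
  · obtain ⟨v, rfl⟩ := x.exists_rep
    obtain ⟨w, rfl⟩ := y.exists_rep
    obtain ⟨_, hg, h⟩ := MSERel.mk_eq_iff.1 hxy
    obtain ⟨g, hgT, rfl⟩ := elemGroupRel_le_map hn hf.surjOn hσ hg
    have hvg := v.isRelRow.of_rowEquiv hn ⟨g, hgT, rfl⟩
    exact MSERel.mk_eq_iff.2
      ⟨g, hgT, hvg.eq_of_comp_eq hf.injOn w.isRelRow ((comp_vecMul f v.1 g).trans h)⟩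
  · obtain ⟨v, rfl⟩ := x.exists_rep
    obtain ⟨V, rfl⟩ := UmRel.map_surjective hf v
    exact ⟨MSERel.mk V, rfl⟩

theorem exists_rowEquiv_comp_vecMul (hn : 3 ≤ n) {Z : Type*} [CommRing Z] {π : T →+* Z}
    {ι : Z →+* R} (hf : ∀ x, f x - ι (π x) ∈ I) {v w : Fin n → T}
    (hv : IsRelRow (RingHom.ker π) v) (hw : IsRelRow (RingHom.ker π) w)
    (h : RowEquiv (elemGroup n T) v w) :
    ∃ k ∈ elemGroup n Z, Pi.single 0 1 ᵥ* k.1 = Pi.single 0 1 ∧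
      RowEquiv (elemGroupRel n R I) (f ∘ v) ((f ∘ w) ᵥ* (GeneralLinearGroup.map ι k).1) := by
  obtain ⟨g, hg, rfl⟩ := h
  rw [isRelRow_ker_iff] at hv hw
  rw [comp_vecMul, hv] at hw
  refine ⟨(GeneralLinearGroup.map π g)⁻¹, inv_mem (elemGroup_map π hg),
    (vecMul_eq_iff_eq_vecMul_inv.1 hw).symm, _,
    map_mul_map_inv_mem_elemGroupRel (f₂ := ι.comp π) hn hf hg, ?_⟩
  rw [Units.val_mul, ← vecMul_vecMul, comp_vecMul, map_inv, GeneralLinearGroup.map_comp]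
  rfl

theorem rowEquiv_comp_single_of_rowEquiv (hn : 3 ≤ n) {Z : Type*} [CommRing Z] {π : T →+* Z}
    {ι : Z →+* R} (hf : ∀ x, f x - ι (π x) ∈ I) {v : Fin n → T} (hv : IsRelRow (RingHom.ker π) v)
    (h : RowEquiv (elemGroup n T) v (Pi.single 0 1)) :
    RowEquiv (elemGroupRel n R I) (f ∘ v) (Pi.single 0 1) := by
  obtain ⟨k, -, hk, hvk⟩ :=
    exists_rowEquiv_comp_vecMul hn hf hv (isRelRow_ker_iff.2 (comp_single_one π 0)) h
  rwa [comp_single_one, ← comp_single_one ι, ← comp_vecMul, hk, comp_single_one] at hvk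

theorem rowEquiv_comp_of_rowEquiv (hn : 3 ≤ n) {Z : Type*} [EuclideanDomain Z] {π : T →+* Z}
    {ι : Z →+* R} (hf : ∀ x, f x - ι (π x) ∈ I) {v w : Fin n → T}
    (hv : IsRelRow (RingHom.ker π) v) (hw : IsRelRow (RingHom.ker π) w)
    (h : RowEquiv (elemGroup n T) v w) : RowEquiv (elemGroupRel n R I) (f ∘ v) (f ∘ w) := by
  obtain ⟨k, hk, hfix, hvk⟩ := exists_rowEquiv_comp_vecMul hn hf hv hw h
  rw [elemGroup_eq_elemGroupOn_univ] at hk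
  have hk₀ : k ∈ elemGroupOn {0}ᶜ Z := by
    refine mem_elemGroupOn_of_det_eq_one (det_eq_one_of_mem_elemGroupOn hk) fun i hi => ?_
    obtain rfl : i = 0 := by simpa using hi
    exact hfix
  have hfw : IsRelRow I (f ∘ w) := hw.map f fun x hx => by
    simpa [RingHom.mem_ker.1 hx] using hf x
  exact hvk.trans (hfw.rowEquiv_vecMul hn (map_mem_elemGroupOn ι hk₀)).symm

end Excision

section ExcisionMap

variable {n : ℕ} [NeZero n] {R : Type*} [CommRing R] {I : Ideal R}

theorem bijOn_ker_fstHom {S : Type*} [CommRing S] [Module S I] [IsScalarTower S I I]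
    [SMulCommClass S I I] {f : Unitization S I →+* R}
    (hf : ∀ y : I, f (Unitization.inr y) = y) :
    Set.BijOn f (RingHom.ker (Unitization.fstHom S I)) I := by
  have h (x : Unitization S I) (hx : x ∈ RingHom.ker (Unitization.fstHom S I)) :
      x = Unitization.inr x.snd := Unitization.ext hx rfl
  refine ⟨fun x hx => ?_, fun x hx y hy hxy => ?_, fun y hy => ?_⟩
  · rw [h x hx, hf]
    exact x.snd.2
  · rw [h x hx, h y hy, hf, hf, Subtype.coe_inj] at hxy
    rw [h x hx, hxy, ← h y hy]
  · exact ⟨Unitization.inr ⟨y, hy⟩, rfl, hf _⟩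

theorem IntExcisionRing.bijOn_toRing (I : Ideal R) :
    Set.BijOn (IntExcisionRing.toRing I) (IntExcisionRing.ideal I) I :=
  bijOn_ker_fstHom fun y => by simp [IntExcisionRing.toRing]

/-- The ideal `0 ⊕ I` of `R ⊕ I`. -/
def ExcisionRing.ideal (I : Ideal R) : Ideal (ExcisionRing I) :=
  RingHom.ker (Unitization.fstHom R I)

/-- The ring homomorphism `R ⊕ I → R`, `(r, i) ↦ r + i`. -/
def ExcisionRing.toRing (I : Ideal R) : ExcisionRing I →+* R where
  toFun x := x.fst + x.snd
  map_one' := by simp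
  map_zero' := by simp
  map_add' x y := by
    simp only [Unitization.fst_add, Unitization.snd_add, Submodule.coe_add]
    ring
  map_mul' x y := by
    simp
    ring

theorem ExcisionRing.bijOn_toRing (I : Ideal R) :
    Set.BijOn (ExcisionRing.toRing I) (ExcisionRing.ideal I) I :=
  bijOn_ker_fstHom fun y => by simp [ExcisionRing.toRing]

theorem ExcisionRing.toRing_comp_inlRingHom (I : Ideal R) :
    (ExcisionRing.toRing I).comp (Unitization.inlRingHom R I) = RingHom.id R :=
  RingHom.ext fun r => by simp [ExcisionRing.toRing]

/-- The map `MSE_n(R, I) → MSE_n(R ⊕ I)` which lifts a row congruent to `e₁` modulo `I` to the row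
congruent to `e₁` modulo `0 ⊕ I`: the analogue of `G ∘ F⁻¹` with `R ⊕ I` in place of `ℤ ⊕ I`. -/
noncomputable def MSERel.toExcision (hn : 3 ≤ n) : MSERel n R I → MSE n (ExcisionRing I) :=
  MSERel.toMSE ∘ (Equiv.ofBijective _ (MSERel.map_bijective hn (ExcisionRing.bijOn_toRing I)
    (ExcisionRing.toRing_comp_inlRingHom I))).symm

theorem MSERel.toExcision_mk_map (hn : 3 ≤ n)
    (V : UmRel n (ExcisionRing I) (ExcisionRing.ideal I)) :
    MSERel.toExcision hn (MSERel.mk (V.map _ (ExcisionRing.bijOn_toRing I).mapsTo)) =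
      MSE.mk ⟨V.1, V.2.1⟩ :=
  congrArg MSERel.toMSE (Equiv.ofBijective_symm_apply_apply _ _ (MSERel.mk V))

/-- The row `e₁`. -/
def UmRel.base (n : ℕ) [NeZero n] (I : Ideal R) : UmRel n R I :=
  ⟨Pi.single 0 1, ⟨Pi.single 0 1, by simp⟩, isRelRow_iff.2 (by simp)⟩

theorem UmRel.base_eq_map : UmRel.base n I =
    (UmRel.base n (ExcisionRing.ideal I)).map _ (ExcisionRing.bijOn_toRing I).mapsTo :=
  Subtype.ext (comp_single_one _ 0).symm

theorem MSERel.eq_mk_base_of_toExcision_eq (hn : 3 ≤ n) {x : MSERel n R I}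
    (hx : MSERel.toExcision hn x = MSERel.toExcision hn (MSERel.mk (UmRel.base n I))) :
    x = MSERel.mk (UmRel.base n I) := by
  obtain ⟨v, rfl⟩ := x.exists_rep
  obtain ⟨V, rfl⟩ := UmRel.map_surjective (ExcisionRing.bijOn_toRing I) v
  rw [UmRel.base_eq_map, MSERel.toExcision_mk_map, MSERel.toExcision_mk_map, MSE.mk_eq_iff] at hx
  refine MSERel.mk_eq_iff.2 (rowEquiv_comp_single_of_rowEquiv hn (ι := RingHom.id R)
    (fun y => ?_) V.isRelRow hx)
  simp [ExcisionRing.toRing]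

end ExcisionMap

section VvRule

variable {n : ℕ} [NeZero n] {R S : Type*} [CommRing R] [CommRing S] {I : Ideal R}

theorem comp_vvRow (f : R →+* S) (v : Fin n → R) (b p : R) :
    f ∘ vvRow v b p = vvRow (f ∘ v) (f b) (f p) := by
  ext j
  simp only [Function.comp_apply, vvRow]
  split_ifs <;> simp

theorem vvRow_single_one : vvRow (Pi.single 0 1 : Fin n → R) 1 1 = Pi.single 0 1 := by
  ext j
  simp only [vvRow, Pi.single_apply]
  grind

theorem IsRelRow.vvRow {v w d : Fin n → R} (hv : IsRelRow I v) (hw : IsRelRow I w)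
    (hd : IsRelRow I d) : IsRelRow I (vvRow v (w 0) (d 0)) := by
  rw [isRelRow_iff_mk_comp] at hv hw hd ⊢
  have hw₀ := congrFun hw 0
  have hd₀ := congrFun hd 0
  rw [Function.comp_apply, Pi.single_eq_same] at hw₀ hd₀
  rw [comp_vvRow, hv, hw₀, hd₀, vvRow_single_one]

theorem IsVvRuleRel.exists_op_eq (hn : 3 ≤ n) {op : MSERel n R I → MSERel n R I → MSERel n R I}
    (hop : IsVvRuleRel op) {v w d : UmRel n R I} (h : ∀ j, j ≠ 0 → w.1 j = v.1 j)
    (hd : v.1 ⬝ᵥ d.1 = 1) :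
    ∃ u : UmRel n R I, u.1 = vvRow v.1 (w.1 0) (d.1 0) ∧
      op (MSERel.mk w) (MSERel.mk v) = MSERel.mk u := by
  obtain ⟨op', hind, hvv⟩ := hop
  have hf := IntExcisionRing.bijOn_toRing I
  obtain ⟨z, hz⟩ := (op (MSERel.mk w) (MSERel.mk v)).exists_rep
  obtain ⟨V, rfl⟩ := UmRel.map_surjective hf v
  obtain ⟨W, rfl⟩ := UmRel.map_surjective hf w
  obtain ⟨D, rfl⟩ := UmRel.map_surjective hf d
  obtain ⟨Z, rfl⟩ := UmRel.map_surjective hf z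
  have hVD : V.1 ⬝ᵥ D.1 = 1 := V.isRelRow.dotProduct_eq_one hf.injOn D.isRelRow hd
  obtain ⟨hU, hrule⟩ := hvv ⟨V.1, V.2.1⟩ ⟨W.1, W.2.1⟩
    (fun j hj => W.isRelRow.apply_eq_of_map_eq hf.injOn V.isRelRow (h j hj))
    (D.1 0) (mul_sub_one_mem_idealOff hVD 0)
  have hrel := V.isRelRow.vvRow W.isRelRow D.isRelRow
  have hequiv := rowEquiv_comp_of_rowEquiv (f := IntExcisionRing.toRing I) (I := I) hn
    (ι := Int.castRingHom R) (fun x => by simp [IntExcisionRing.toRing]) Z.isRelRow hrel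
    (MSE.mk_eq_iff.1 ((hind (MSERel.mk W) (MSERel.mk V) (MSERel.mk Z) hz).symm.trans hrule))
  exact ⟨UmRel.map _ hf.mapsTo ⟨_, hU, hrel⟩, comp_vvRow _ _ _ _,
    hz.symm.trans (MSERel.mk_eq_iff.2 hequiv)⟩

theorem IsVvRule.op_toExcision_eq (hn : 3 ≤ n)
    {op : MSE n (ExcisionRing I) → MSE n (ExcisionRing I) → MSE n (ExcisionRing I)}
    (hop : IsVvRule op) {u v w d : UmRel n R I} (h : ∀ j, j ≠ 0 → w.1 j = v.1 j)
    (hd : v.1 ⬝ᵥ d.1 = 1) (hu : u.1 = vvRow v.1 (w.1 0) (d.1 0)) :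
    op (MSERel.toExcision hn (MSERel.mk w)) (MSERel.toExcision hn (MSERel.mk v)) =
      MSERel.toExcision hn (MSERel.mk u) := by
  have hf := ExcisionRing.bijOn_toRing I
  obtain ⟨V, rfl⟩ := UmRel.map_surjective hf v
  obtain ⟨W, rfl⟩ := UmRel.map_surjective hf w
  obtain ⟨D, rfl⟩ := UmRel.map_surjective hf d
  have hVD : V.1 ⬝ᵥ D.1 = 1 := V.isRelRow.dotProduct_eq_one hf.injOn D.isRelRow hd
  obtain ⟨hU, hrule⟩ := hop ⟨V.1, V.2.1⟩ ⟨W.1, W.2.1⟩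
    (fun j hj => W.isRelRow.apply_eq_of_map_eq hf.injOn V.isRelRow (h j hj))
    (D.1 0) (mul_sub_one_mem_idealOff hVD 0)
  have hmap : u = UmRel.map _ hf.mapsTo
      ⟨_, hU, V.isRelRow.vvRow W.isRelRow D.isRelRow⟩ :=
    Subtype.ext (hu.trans (comp_vvRow _ _ _ _).symm)
  simpa only [hmap, MSERel.toExcision_mk_map] using hrule

end VvRule

section CommonTails

variable {n : ℕ} [NeZero n] {R : Type*} [CommRing R] {I : Ideal R}

/-- Two classes in `MSE_n(R, I)` have representatives which agree outside the first coordinate, so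
that the Vaserstein–van der Kallen rule computes their product. -/
def HaveCommonTail (x y : MSERel n R I) : Prop :=
  ∃ v w : UmRel n R I, MSERel.mk v = x ∧ MSERel.mk w = y ∧ ∀ j, j ≠ 0 → w.1 j = v.1 j

theorem HaveCommonTail.symm {x y : MSERel n R I} : HaveCommonTail x y → HaveCommonTail y x := by
  rintro ⟨v, w, hv, hw, h⟩
  exact ⟨w, v, hw, hv, fun j hj => (h j hj).symm⟩

theorem exists_commonTail_update (hn : 3 ≤ n) {i : Fin n} (hi : i ≠ 0) {v w : UmRel n R I}
    (h : ∀ j, j ≠ 0 → j ≠ i → w.1 j = v.1 j) {σ : R} (hσ : w.1 i * σ - 1 ∈ idealOff v.1 i) :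
    ∃ v' w' : UmRel n R I, MSERel.mk v' = MSERel.mk v ∧ MSERel.mk w' = MSERel.mk w ∧
      (∀ j, j ≠ 0 → w'.1 j = v'.1 j) ∧ ∀ j, j ≠ i → v'.1 j = v.1 j := by
  have hw₀ : 1 - w.1 0 ∈ I := sub_mem_comm_iff.1 w.2.2.1
  have hdiff : w.1 i - v.1 i ∈ I := I.sub_mem (w.2.2.2 i hi) (v.2.2.2 i hi)
  -- `b ≡ w₀` modulo `w_i` and `b ≡ 1` modulo the entries of `v` other than `v_i`
  let b := w.1 0 + σ * (1 - w.1 0) * w.1 i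
  have hb : 1 - b ∈ idealOff v.1 i := by
    convert Ideal.mul_mem_left _ (-(1 - w.1 0)) hσ using 1
    ring
  let t := v.1 i + (1 - b) * (w.1 i - v.1 i)
  have hv' : RowEquiv (elemGroupRel n R I) v.1 (Function.update v.1 i t) :=
    rowEquiv_update_of_mem_idealOff hn hb hdiff
  have hwb : RowEquiv (elemGroupRel n R I) w.1 (Function.update w.1 0 b) :=
    rowEquiv_update hn hi (I.mul_mem_left σ hw₀) w.1
  have hw' : RowEquiv (elemGroupRel n R I) w.1 (Function.update (Function.update w.1 0 b) i t) := by
    convert hwb.trans (rowEquiv_update hn hi.symm (I.neg_mem hdiff) _) using 2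
    rw [Function.update_of_ne hi, Function.update_self]
    ring
  refine ⟨⟨_, hv'.isUnimodular v.2.1, v.isRelRow.of_rowEquiv hn hv'⟩,
    ⟨_, hw'.isUnimodular w.2.1, w.isRelRow.of_rowEquiv hn hw'⟩, MSERel.mk_eq_iff.2 hv'.symm,
    MSERel.mk_eq_iff.2 hw'.symm, fun j hj => ?_, fun j hj => Function.update_of_ne hj _ _⟩
  obtain rfl | hji := eq_or_ne j i
  · simp
  · simp [hj, hji, h j hj hji]

theorem haveCommonTail_of_mul_sub_one_mem_idealOff (hn : 3 ≤ n) {i : Fin n} (hi : i ≠ 0)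
    {v w : UmRel n R I} (h : ∀ j, j ≠ 0 → j ≠ i → w.1 j = v.1 j) {σ : R}
    (hσ : w.1 i * σ - 1 ∈ idealOff v.1 i) : HaveCommonTail (MSERel.mk v) (MSERel.mk w) := by
  obtain ⟨v', w', hv, hw, htail, -⟩ := exists_commonTail_update hn hi h hσ
  exact ⟨v', w', hv, hw, htail⟩

theorem exists_mul_sub_one_mem_idealOff {v w : UmRel n R I} {i : Fin n}
    (h : ∀ j, j ≠ i → w.1 j = v.1 j) : ∃ σ, w.1 i * σ - 1 ∈ idealOff v.1 i := by
  obtain ⟨d, hd⟩ := w.2.1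
  exact ⟨d i, idealOff_congr h ▸ mul_sub_one_mem_idealOff hd i⟩

theorem haveCommonTail_of_agree (hn : 3 ≤ n) {i : Fin n} {v w : UmRel n R I}
    (h : ∀ j, j ≠ i → w.1 j = v.1 j) : HaveCommonTail (MSERel.mk v) (MSERel.mk w) := by
  obtain rfl | hi := eq_or_ne i 0
  · exact ⟨v, w, rfl, rfl, h⟩
  · obtain ⟨σ, hσ⟩ := exists_mul_sub_one_mem_idealOff h
    exact haveCommonTail_of_mul_sub_one_mem_idealOff hn hi (fun j _ => h j) hσ

theorem HaveCommonTail.toExcision_mul [Group (MSERel n R I)] [Group (MSE n (ExcisionRing I))]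
    (hn : 3 ≤ n) (hrel : IsVvRuleRel (fun x y : MSERel n R I => x * y))
    (habs : IsVvRule (fun x y : MSE n (ExcisionRing I) => x * y)) {x y : MSERel n R I}
    (h : HaveCommonTail x y) :
    MSERel.toExcision hn (y * x) = MSERel.toExcision hn y * MSERel.toExcision hn x := by
  obtain ⟨v, w, rfl, rfl, hagree⟩ := h
  obtain ⟨d, hd⟩ := v.exists_dual
  obtain ⟨u, hu, hmul⟩ := hrel.exists_op_eq hn hagree hd
  exact (congrArg _ hmul).trans (habs.op_toExcision_eq hn hagree hd hu).symm

end CommonTails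

section Nice

variable {n : ℕ} {A : Type*} [CommRing A]

theorem isUnimodular_update {v d : Fin n → A} (h : v ⬝ᵥ d = 1) (i : Fin n) :
    IsUnimodular (Function.update v i (d i)) := by
  refine ⟨Function.update d i (v i), h ▸ Finset.sum_congr rfl fun j _ => ?_⟩
  obtain rfl | hj := eq_or_ne j i
  · simp [mul_comm]
  · simp [hj]

variable [NeZero n]

/-- The elementary matrix `E_{i0}(1) E_{0i}(-1) E_{i0}(1)`, which exchanges the coordinates `0` and
`i` of a row up to a sign. -/
def swapGL {i : Fin n} (hi : i ≠ 0) : GL (Fin n) A :=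
  elemGL hi 1 * elemGL hi.symm (-1) * elemGL hi 1

theorem swapGL_mem_elemGroup {i : Fin n} (hi : i ≠ 0) : swapGL hi ∈ elemGroup n A :=
  mul_mem (mul_mem (elemGL_mem_elemGroup _ _) (elemGL_mem_elemGroup _ _)) (elemGL_mem_elemGroup _ _)

theorem vecMul_swapGL {i : Fin n} (hi : i ≠ 0) (v : Fin n → A) :
    v ᵥ* (swapGL hi).1 = Function.update (Function.update v i (-v 0)) 0 (v i) := by
  simp only [swapGL, Units.val_mul, ← vecMul_vecMul, vecMul_elemGL]
  ext j
  simp only [Function.update_apply]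
  grind

theorem IsNice.apply_coord {op : MSE n A → MSE n A → MSE n A} (hop : IsNice op) {i : Fin n}
    {v w : Um n A} (h : ∀ j, j ≠ i → w.1 j = v.1 j) :
    ∃ hu : IsUnimodular (Function.update v.1 i (v.1 i * w.1 i)),
      op (MSE.mk w) (MSE.mk v) = MSE.mk ⟨Function.update v.1 i (v.1 i * w.1 i), hu⟩ := by
  obtain rfl | hi := eq_or_ne i 0
  · exact hop v w h
  let s (v : Um n A) : Um n A := ⟨v.1 ᵥ* (swapGL hi).1, v.2.vecMul _⟩
  have hs (v : Um n A) : MSE.mk v = MSE.mk (s v) :=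
    MSE.mk_eq_iff.2 ⟨_, swapGL_mem_elemGroup hi, rfl⟩
  obtain ⟨hu, hop⟩ := hop (s v) (s w) fun j hj => by
    simp only [s, vecMul_swapGL, Function.update_apply]
    grind
  have hswap : Function.update (s v).1 0 ((s v).1 0 * (s w).1 0) =
      Function.update v.1 i (v.1 i * w.1 i) ᵥ* (swapGL hi).1 := by
    ext j
    simp only [s, vecMul_swapGL, Function.update_apply]
    grind
  have hequiv : RowEquiv (elemGroup n A) (Function.update v.1 i (v.1 i * w.1 i)) _ :=
    ⟨_, swapGL_mem_elemGroup hi, hswap.symm⟩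
  refine ⟨hequiv.symm.isUnimodular hu, ?_⟩
  rw [hs w, hs v, hop]
  exact MSE.mk_eq_iff.2 hequiv.symm

variable [Group (MSE n A)]

theorem IsNice.mk_eq_one_of_sub_one_mem_idealOff (hn : 3 ≤ n)
    (hnice : IsNice (fun x y : MSE n A => x * y)) {i : Fin n} {v : Um n A}
    (hv : v.1 i - 1 ∈ idealOff v.1 i) : MSE.mk v = 1 := by
  have hequiv : RowEquiv (elemGroup n A) v.1 (Function.update v.1 i 1) := by
    simpa using (rowEquiv_update_of_mem_idealOff (I := ⊤) hn (neg_mem hv)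
      (Submodule.mem_top (x := 1))).mono elemGroupRel_le_elemGroup
  let q : Um n A := ⟨Function.update v.1 i 1, hequiv.isUnimodular v.2⟩
  obtain ⟨hu, hmul⟩ := hnice.apply_coord (i := i) (v := q) (w := q) fun _ _ => rfl
  have hqq : MSE.mk q * MSE.mk q = MSE.mk q :=
    hmul.trans (congrArg MSE.mk (Subtype.ext (by simp [q])))
  exact (MSE.mk_eq_iff.2 hequiv : MSE.mk v = MSE.mk q).trans (mul_eq_left.1 hqq)

theorem IsNice.mk_mul_mk_eq_one (hn : 3 ≤ n) (hnice : IsNice (fun x y : MSE n A => x * y))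
    {i : Fin n} {v c : Um n A} {d : Fin n → A} (hd : v.1 ⬝ᵥ d = 1)
    (hc : c.1 = Function.update v.1 i (d i)) : MSE.mk c * MSE.mk v = 1 := by
  obtain ⟨hu, hmul⟩ := hnice.apply_coord (i := i) (v := v) (w := c)
    fun j hj => by rw [hc, Function.update_of_ne hj]
  refine hmul.trans (hnice.mk_eq_one_of_sub_one_mem_idealOff hn (i := i) ?_)
  rw [idealOff_congr (v := v.1) fun j hj => Function.update_of_ne hj _ _]
  simpa [hc] using mul_sub_one_mem_idealOff hd i

end Nice

section NiceExcision

variable {n : ℕ} [NeZero n] {R : Type*} [CommRing R] {I : Ideal R}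

theorem IsNice.exists_op_toExcision_eq (hn : 3 ≤ n)
    {op : MSE n (ExcisionRing I) → MSE n (ExcisionRing I) → MSE n (ExcisionRing I)}
    (hop : IsNice op) {i : Fin n} {v w : UmRel n R I} (h : ∀ j, j ≠ i → w.1 j = v.1 j) :
    ∃ u : UmRel n R I, u.1 = Function.update v.1 i (v.1 i * w.1 i) ∧
      op (MSERel.toExcision hn (MSERel.mk w)) (MSERel.toExcision hn (MSERel.mk v)) =
        MSERel.toExcision hn (MSERel.mk u) := by
  have hf := ExcisionRing.bijOn_toRing I
  obtain ⟨V, rfl⟩ := UmRel.map_surjective hf v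
  obtain ⟨W, rfl⟩ := UmRel.map_surjective hf w
  obtain ⟨hU, hmul⟩ := hop.apply_coord (i := i) (v := ⟨V.1, V.2.1⟩) (w := ⟨W.1, W.2.1⟩)
    fun j hj => W.isRelRow.apply_eq_of_map_eq hf.injOn V.isRelRow (h j hj)
  refine ⟨UmRel.map _ hf.mapsTo ⟨_, hU, V.isRelRow.update (V.isRelRow.mul_apply W.isRelRow i)⟩,
    ?_, ?_⟩
  · simp [UmRel.map, Function.comp_update]
  · simpa only [MSERel.toExcision_mk_map] using hmul

variable [Group (MSE n (ExcisionRing I))]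

theorem IsNice.exists_toExcision_mul_eq_one (hn : 3 ≤ n)
    (hnice : IsNice (fun x y : MSE n (ExcisionRing I) => x * y)) (i : Fin n) (u : UmRel n R I) :
    ∃ c : UmRel n R I, (∀ j, j ≠ i → c.1 j = u.1 j) ∧
      MSERel.toExcision hn (MSERel.mk c) * MSERel.toExcision hn (MSERel.mk u) = 1 := by
  have hf := ExcisionRing.bijOn_toRing I
  obtain ⟨U, rfl⟩ := UmRel.map_surjective hf u
  obtain ⟨D, hD⟩ := U.exists_dual
  let C : UmRel n (ExcisionRing I) (ExcisionRing.ideal I) :=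
    ⟨_, isUnimodular_update hD i, U.isRelRow.update (isRelRow_iff.1 D.isRelRow i)⟩
  refine ⟨UmRel.map _ hf.mapsTo C, fun j hj => ?_, ?_⟩
  · simp [UmRel.map, C, hj]
  · simpa only [MSERel.toExcision_mk_map] using hnice.mk_mul_mk_eq_one hn hD rfl

theorem MSERel.toExcision_mk_base (hn : 3 ≤ n)
    (hnice : IsNice (fun x y : MSE n (ExcisionRing I) => x * y)) :
    MSERel.toExcision hn (MSERel.mk (UmRel.base n I)) = 1 := by
  rw [UmRel.base_eq_map, MSERel.toExcision_mk_map]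
  exact hnice.mk_eq_one_of_sub_one_mem_idealOff hn (i := 0) (by simp [UmRel.base])

variable [Group (MSERel n R I)]

theorem MSERel.eq_one_of_toExcision_eq_one (hn : 3 ≤ n)
    (hrel : IsVvRuleRel (fun x y : MSERel n R I => x * y))
    (habs : IsVvRule (fun x y : MSE n (ExcisionRing I) => x * y))
    (hnice : IsNice (fun x y : MSE n (ExcisionRing I) => x * y)) {x : MSERel n R I}
    (hx : MSERel.toExcision hn x = 1) : x = 1 := by
  have hbase := MSERel.toExcision_mk_base hn hnice
  have hmul := (haveCommonTail_of_agree hn (v := UmRel.base n I) (i := 0)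
    fun _ _ => rfl).toExcision_mul hn hrel habs
  rw [hbase, mul_one, ← hbase] at hmul
  rw [MSERel.eq_mk_base_of_toExcision_eq hn (hx.trans hbase.symm),
    mul_eq_left.1 (MSERel.eq_mk_base_of_toExcision_eq hn hmul)]

theorem MSERel.eq_mk_of_toExcision_eq (hn : 3 ≤ n)
    (hrel : IsVvRuleRel (fun x y : MSERel n R I => x * y))
    (habs : IsVvRule (fun x y : MSE n (ExcisionRing I) => x * y))
    (hnice : IsNice (fun x y : MSE n (ExcisionRing I) => x * y)) {x : MSERel n R I}
    {u : UmRel n R I} (hxu : MSERel.toExcision hn x = MSERel.toExcision hn (MSERel.mk u))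
    (i : Fin n) (htail : ∀ c : UmRel n R I, (∀ j, j ≠ i → c.1 j = u.1 j) →
      HaveCommonTail x (MSERel.mk c)) : x = MSERel.mk u := by
  obtain ⟨c, hc, hcu⟩ := hnice.exists_toExcision_mul_eq_one hn i u
  have hcx₁ : MSERel.mk c * x = 1 :=
    MSERel.eq_one_of_toExcision_eq_one hn hrel habs hnice <| by
      rw [(htail c hc).toExcision_mul hn hrel habs, hxu, hcu]
  have hcu₁ : MSERel.mk c * MSERel.mk u = 1 :=
    MSERel.eq_one_of_toExcision_eq_one hn hrel habs hnice <| by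
      rw [(haveCommonTail_of_agree hn hc).toExcision_mul hn hrel habs, hcu]
  exact mul_left_cancel (hcx₁.trans hcu₁.symm)

theorem MSERel.exists_mk_mul_mk_eq_mk_update_zero (hn : 3 ≤ n)
    (hrel : IsVvRuleRel (fun x y : MSERel n R I => x * y))
    (habs : IsVvRule (fun x y : MSE n (ExcisionRing I) => x * y))
    (hnice : IsNice (fun x y : MSE n (ExcisionRing I) => x * y)) {v w : UmRel n R I}
    (h : ∀ j, j ≠ 0 → w.1 j = v.1 j) :
    ∃ u : UmRel n R I, u.1 = Function.update v.1 0 (v.1 0 * w.1 0) ∧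
      MSERel.mk w * MSERel.mk v = MSERel.mk u := by
  obtain ⟨d, hd⟩ := v.exists_dual
  obtain ⟨r, hr, hmul⟩ := hrel.exists_op_eq hn h hd
  obtain ⟨u, hu, hφu⟩ := hnice.exists_op_toExcision_eq hn h
  have hφr := habs.op_toExcision_eq hn h hd hr
  refine ⟨u, hu, hmul.trans ?_⟩
  refine MSERel.eq_mk_of_toExcision_eq hn hrel habs hnice (hφr.symm.trans hφu) 0 fun c hc => ?_
  have h10 := fin_one_ne_zero hn
  -- `r₁ = c₁ (w₀ + d₀)` is invertible modulo the other entries of `r`, hence so is `c₁`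
  obtain ⟨e, he⟩ := r.2.1
  have hr₁ := mul_sub_one_mem_idealOff he 1
  rw [show r.1 1 * e 1 = c.1 1 * ((w.1 0 + d.1 0) * e 1) by
    simp [hr, hc, hu, vvRow, h10, mul_assoc]] at hr₁
  exact haveCommonTail_of_mul_sub_one_mem_idealOff hn h10
    (fun j hj hj1 => by simp [hr, hc, hu, vvRow, hj, hj1]) hr₁

theorem MSERel.exists_mk_mul_mk_eq_mk_update_of_ne_zero (hn : 3 ≤ n)
    (hrel : IsVvRuleRel (fun x y : MSERel n R I => x * y))
    (habs : IsVvRule (fun x y : MSE n (ExcisionRing I) => x * y))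
    (hnice : IsNice (fun x y : MSE n (ExcisionRing I) => x * y)) {i : Fin n} (hi : i ≠ 0)
    {v w : UmRel n R I} (h : ∀ j, j ≠ i → w.1 j = v.1 j) :
    ∃ u : UmRel n R I, u.1 = Function.update v.1 i (v.1 i * w.1 i) ∧
      MSERel.mk w * MSERel.mk v = MSERel.mk u := by
  obtain ⟨u, hu, hφu⟩ := hnice.exists_op_toExcision_eq hn h
  have hφ := (haveCommonTail_of_agree hn h).toExcision_mul hn hrel habs
  refine ⟨u, hu, MSERel.eq_mk_of_toExcision_eq hn hrel habs hnice (hφ.trans hφu) i fun c hc => ?_⟩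
  obtain ⟨σ, hσ⟩ := exists_mul_sub_one_mem_idealOff h
  obtain ⟨v', w', hv', hw', htail, hvv'⟩ := exists_commonTail_update hn hi (fun j _ => h j) hσ
  obtain ⟨r, hr, hmul⟩ :=
    MSERel.exists_mk_mul_mk_eq_mk_update_zero hn hrel habs hnice htail
  have hcv' : ∀ j, j ≠ i → c.1 j = v'.1 j := fun j hj => by simp [hc, hu, hvv', hj]
  obtain ⟨e, he⟩ := v'.2.1
  have hri := mul_sub_one_mem_idealOff he i
  rw [← idealOff_congr hcv', show v'.1 i = r.1 i by simp [hr, hi]] at hri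
  rw [← hv', ← hw', hmul]
  exact (haveCommonTail_of_mul_sub_one_mem_idealOff hn hi
    (fun j hj hji => by simp [hr, hj, hcv' j hji]) hri).symm

end NiceExcision

theorem mainTheorem5 (n : ℕ) [NeZero n] (hn : 3 ≤ n) {R : Type*} [CommRing R] (I : Ideal R)
    [Group (MSERel n R I)] [Group (MSE n (ExcisionRing I))]
    (hrel : IsVvRuleRel (fun x y : MSERel n R I => x * y))
    (habs : IsVvRule (fun x y : MSE n (ExcisionRing I) => x * y))
    (hnice : IsNice (fun x y : MSE n (ExcisionRing I) => x * y)) :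
    IsNiceRel (fun x y : MSERel n R I => x * y) := by
  intro i v w h
  obtain rfl | hi := eq_or_ne i 0
  · exact MSERel.exists_mk_mul_mk_eq_mk_update_zero hn hrel habs hnice h
  · exact MSERel.exists_mk_mul_mk_eq_mk_update_of_ne_zero hn hrel habs hnice hi h
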